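/- Let $\mathcal C$ be a semi-abelian variety of universal algebras, i.e. the category of all algebras for some set of finitary operations and some set of identities, such that $\mathcal C$ is a semi-abelian category: it is pointed, regular and finitely cocomplete, the Split Short Five Lemma holds in it, and every internal equivalence relation is a kernel pair. Let $A$ be an object of $\mathcal C$, let $\mathcal X\subseteq\mathcal C$ be the full subcategory of $A$-null objects, i.e. of those $Z$ with $\operatorname{Hom}(A,Z)=0$. Then $\mathcal X$ is reflective. Let $F\colon\mathcal C\to\mathcal X$ be any reflector, $U\colon \mathcal X\to\mathcal C$ the inclusion, $P_A=UF\colon\mathcal C\to\mathcal C$ the $A$-nullification functor and $\eta\colon 1\Rightarrow P_A$ the unit. An extension is a sequence $0\to K\xrightarrow{k} E\xrightarrow{f} Q\to 0$ in which $k$ is a kernel of $f$ and $f$ is a cokernel of $k$. Assume that $P_A$ admits a functorial fiberwise localization, i.e. that there is a functorial assignment to each extension $0\to K\to E\to Q\to 0$ of an extension $0\to P_A(K)\to\overline E\to Q\to 0$ and of a morphism from the former to the latter that is given by $\eta_K$ on $K$, by a morphism $e\colon E\to\overline E$ with $P_A(e)$ an isomorphism, and by the identity on $Q$. Then: 1.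 $P_A$ is semi-left-exact: $F$ preserves every pullback of $\eta_C\colon C\to UF(C)$ along a morphism $g\colon X\to UF(C)$ with $C$ in $\mathcal C$ and $X$ in $\mathcal X$. 2. In particular $P_A$ is conditionally flat: if $P_A$ sends an extension $0\to K\to E\to Q\to 0$ to an extension $0\to P_A(K)\to P_A(E)\to P_A(Q)\to 0$, then for every morphism $X\to Q$ the pulled back sequence $0\to K\to E\times_Q X\to X\to 0$ is an extension that is again sent by $P_A$ to an extension. 3. Consequently the $P_A$-local model structure on $\mathcal C$ is right proper. That is, there is a model structure on $\mathcal C$ in which the weak equivalences are the morphisms $w$ with $P_A(w)$ an isomorphism, all morphisms are cofibrations, and the fibrations are the morphisms with the unique right lifting property with respect to all weak equivalences; and in it the pullback of a weak equivalence along a fibration is a weak equivalence. -/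

import Mathlib

open CategoryTheory CategoryTheory.Limits HomotopicalAlgebra
open scoped FirstOrder

universe u v w

namespace SemiAb

/-! ### Varieties of universal algebras -/

section Variety

variable {L : FirstOrder.Language.{u, v}}

/-- The algebras of the variety given by the signature `L` (a language without relation symbols;
each operation symbol has a finite arity) and the set `E` of identities `s = t` between terms in
the variables `x₀, x₁, …`: sets with operations satisfying all the identities of `E`. -/
structure Alg (E : Set (L.Term ℕ × L.Term ℕ)) where
  carrier : Type w
  [str : L.Structure carrier]
  sat : ∀ e ∈ E, ∀ x : ℕ → carrier, e.1.realize x = e.2.realize x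

attribute [instance] Alg.str

/-- The variety as a category: the morphisms are the maps that commute with all operations. -/
instance Alg.category (E : Set (L.Term ℕ × L.Term ℕ)) : Category.{w} (Alg.{u, v, w} E) where
  Hom M N := M.carrier →[L] N.carrier
  id M := FirstOrder.Language.Hom.id L M.carrier
  comp f g := FirstOrder.Language.Hom.comp g f

end Variety

/-! ### Homological and semi-abelian categories -/

section SemiAbelian

variable (C : Type u) [Category.{v} C] [HasZeroMorphisms C]

/-- The Split Short Five Lemma: in a morphism `(u, v, w)` of split epimorphisms with kernels, if
`u` and `w` are isomorphisms then so is `v`. -/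
def SplitShortFiveLemma : Prop :=
  ∀ ⦃K A B K' A' B' : C⦄ (k : K ⟶ A) (f : A ⟶ B) (s : B ⟶ A)
    (k' : K' ⟶ A') (f' : A' ⟶ B') (s' : B' ⟶ A') (hk : k ≫ f = 0) (hk' : k' ≫ f' = 0)
    (u : K ⟶ K') (v : A ⟶ A') (w : B ⟶ B'),
    Nonempty (IsLimit (KernelFork.ofι k hk)) → Nonempty (IsLimit (KernelFork.ofι k' hk')) →
    s ≫ f = 𝟙 B → s' ≫ f' = 𝟙 B' →
    k ≫ v = u ≫ k' → f ≫ w = v ≫ f' → s ≫ v = w ≫ s' →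
    IsIso u → IsIso w → IsIso v

/-- A homological category: a pointed regular category in which the Split Short Five Lemma
holds. -/
class Homological : Prop where
  regular : Regular C
  hasZeroObject : HasZeroObject C
  splitShortFive : SplitShortFiveLemma C

/-- A semi-abelian category: a finitely cocomplete homological category in which every internal
equivalence relation is a kernel pair. -/
class SemiAbelian : Prop extends Homological C where
  hasFiniteColimits : HasFiniteColimits C
  exact : ∀ ⦃R X : C⦄ (p₁ p₂ : R ⟶ X), IsEquivalenceRelation p₁ p₂ →
    ∃ (Y : C) (f : X ⟶ Y), IsKernelPair f p₁ p₂

end SemiAbelian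

/-! ### Extensions, flatness, fiberwise localization -/

section Extensions

variable {C : Type u} [Category.{v} C] [HasZeroMorphisms C]

/-- `0 → K → E → Q → 0` is an extension (a short exact sequence): `K → E` is a kernel of `E → Q`
and `E → Q` is a cokernel of `K → E`. -/
structure IsExtension (S : ShortComplex C) : Prop where
  isKernel : Nonempty (IsLimit (KernelFork.ofι S.f S.zero))
  isCokernel : Nonempty (IsColimit (CokernelCofork.ofπ S.g S.zero))

variable (C) in
/-- Extensions, as a property of objects of the category of sequences `K ⟶ E ⟶ Q` with zero
composite. -/
def extensions : ObjectProperty (ShortComplex C) := fun S => IsExtension S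

/-- `S` is an extension that `F` sends to an extension `0 → F K → F E → F Q → 0`. -/
def IsFlatExtension (F : C ⥤ C) (S : ShortComplex C) : Prop :=
  IsExtension S ∧ ∃ h : F.map S.f ≫ F.map S.g = 0, IsExtension (ShortComplex.mk _ _ h)

/-- `F` is conditionally flat: every pullback of an `F`-flat extension is an `F`-flat extension.
The sequence `K' ⟶ P ⟶ X` is a pullback of `K ⟶ E ⟶ Q` along `X ⟶ Q` if `P` is the pullback of
`E ⟶ Q` along `X ⟶ Q` and the induced map `K' ⟶ K` is an isomorphism. -/
def ConditionallyFlat (F : C ⥤ C) : Prop :=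
  ∀ ⦃S' S : ShortComplex C⦄ (φ : S' ⟶ S), IsFlatExtension F S →
    IsIso φ.τ₁ → IsPullback φ.τ₂ S'.g S.g φ.τ₃ → IsFlatExtension F S'

/-- A functorial fiberwise localization for `(F, η)`: to each extension `0 → K → E → Q → 0` it
assigns, functorially, an extension `0 → F K → Ē → Q → 0` and a morphism of extensions
```
0 ⟶  K  ⟶ E ⟶ Q ⟶ 0
     |η    |e   ‖
0 ⟶ F K ⟶ Ē ⟶ Q ⟶ 0
```
such that `e` is inverted by `F`. -/
structure FunctorialFiberwiseLocalization (F : C ⥤ C) (η : 𝟭 C ⟶ F) where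
  Ebar : (extensions C).FullSubcategory ⥤ C
  j : (extensions C).ι ⋙ ShortComplex.π₁ ⋙ F ⟶ Ebar
  q : Ebar ⟶ (extensions C).ι ⋙ ShortComplex.π₃
  e : (extensions C).ι ⋙ ShortComplex.π₂ ⟶ Ebar
  zero : ∀ S, j.app S ≫ q.app S = 0
  isExtension : ∀ S, IsExtension (ShortComplex.mk _ _ (zero S))
  comm_left : ∀ S, η.app S.obj.X₁ ≫ j.app S = S.obj.f ≫ e.app S
  comm_right : ∀ S, e.app S ≫ q.app S = S.obj.g
  inverted : ∀ S, IsIso (F.map (e.app S))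

end Extensions

/-! ### Reflections -/

section Reflections

variable {C : Type u} [Category.{v} C]

/-- The localization functor `U F : C ⥤ C` of a full reflective subcategory. -/
def localization (P : ObjectProperty C) [Reflective P.ι] : C ⥤ C := reflector P.ι ⋙ P.ι

/-- The coaugmentation `η` of the localization functor of a full reflective subcategory. -/
def coaugmentation (P : ObjectProperty C) [Reflective P.ι] : 𝟭 C ⟶ localization P :=
  (reflectorAdjunction P.ι).unit

/-- The reflector `F` onto `P` is semi-left-exact: it preserves the pullbacks of the form
```
W --p₂--> X
|p₁       |g
C --η---> U F C
```
where `g` is a morphism between objects of the subcategory. -/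
def SemiLeftExact (P : ObjectProperty C) [Reflective P.ι] : Prop :=
  ∀ ⦃W Y : C⦄ ⦃X : P.FullSubcategory⦄ (p₁ : W ⟶ Y) (p₂ : W ⟶ P.ι.obj X)
    (g : X ⟶ (reflector P.ι).obj Y),
    IsPullback p₁ p₂ ((reflectorAdjunction P.ι).unit.app Y) (P.ι.map g) →
    IsPullback ((reflector P.ι).map p₁) ((reflector P.ι).map p₂)
      ((reflector P.ι).map ((reflectorAdjunction P.ι).unit.app Y))
      ((reflector P.ι).map (P.ι.map g))

/-- The `A`-null objects: the objects `Z` with `Hom(A, Z) = 0`. If they form a reflective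
subcategory, the associated localization functor is the `A`-nullification `P_A`. -/
def nullObjects [HasZeroMorphisms C] (A : C) : ObjectProperty C := fun Z => ∀ f : A ⟶ Z, f = 0

end Reflections

/-! ### The local model structure -/

section Model

variable {C : Type u} [Category.{v} C]

/-- The `F`-equivalences: the morphisms that `F` sends to isomorphisms. -/
def equivalences (F : C ⥤ C) : MorphismProperty C := fun _ _ f => IsIso (F.map f)

/-- The class `W^⊥` of the morphisms with the *unique* right lifting property against all
morphisms of `W`. -/
def rightOrthogonal (W : MorphismProperty C) : MorphismProperty C := fun X Y p =>
  ∀ ⦃A B : C⦄ (f : A ⟶ B), W f → ∀ (a : A ⟶ X) (b : B ⟶ Y), a ≫ p = f ≫ b →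
    ∃! l : B ⟶ X, f ≫ l = a ∧ l ≫ p = b

/-- The `F`-local model structure: the weak equivalences are the `F`-equivalences, all morphisms
are cofibrations, and the fibrations are the morphisms right orthogonal to the
`F`-equivalences. -/
def IsLocalModelStructure (F : C ⥤ C) (_M : ModelCategory C) : Prop :=
  weakEquivalences C = equivalences F ∧ cofibrations C = ⊤ ∧
    fibrations C = rightOrthogonal (equivalences F)

/-- A model structure is right proper if the pullback of any weak equivalence `X ⟶ B` along any
fibration `E ⟶ B` is a weak equivalence. -/
def RightProper (_M : ModelCategory C) : Prop :=
  ∀ ⦃P E X B : C⦄ (t : P ⟶ E) (l : P ⟶ X) (p : E ⟶ B) (r : X ⟶ B), IsPullback t l p r →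
    fibrations C p → weakEquivalences C r → weakEquivalences C t

end Model

end SemiAb

/-! Everything rests on one fact: the kernel of each unit `η_X : X ⟶ P_A X` has only zero morphisms
to null objects. Since `η_X` is surjective, `0 → K → X → P_A X → 0` is an extension, and its
fiberwise localization has a middle term that is an extension of null objects, hence null. So `X ⟶
Ē` factors through `η_X` and kills `K`. As `P_A K ⟶ Ē` is injective, `η_K = 0`
(`FunctorialFiberwiseLocalization.nullCover_coaug`).

Surjections with such a kernel (`NullCover`) are stable under pullback and are inverted by `P_A`,
because they are cokernels of their kernels. Hence pullbacks of units along morphisms from null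
objects are inverted (`PullsBackCoaug`), which is semi-left-exactness.

For a flat extension the comparison `E ⟶ P_A E ×_{P_A Q} Q` is itself a null cover. Pulling it back
along `X ⟶ Q` identifies `P_A (E ×_Q X)` with `P_A E ×_{P_A Q} P_A X`, so the localized sequence is
again a pullback of an extension.

The model structure comes from the factorization `X ⟶ P_A X ×_{P_A Y} Y ⟶ Y`. Fibrations are then
pullbacks of their localizations, which gives right properness. -/

namespace SemiAb

/-! ### Algebras of a variety, element by element. -/

section Algebras

open FirstOrder FirstOrder.Language FirstOrder.Language.Structure

variable {L : FirstOrder.Language.{u, v}} {E : Set (L.Term ℕ × L.Term ℕ)}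

/-- The underlying map of a morphism of algebras. -/
def Alg.fn {M N : Alg.{u, v, w} E} (f : M ⟶ N) : M.carrier → N.carrier :=
  Language.Hom.toFun (L := L) (M := M.carrier) (N := N.carrier) f

instance {M N : Alg.{u, v, w} E} : CoeFun (M ⟶ N) fun _ => M.carrier → N.carrier := ⟨Alg.fn⟩

namespace Alg

@[simp] lemma comp_fn {M N P : Alg.{u, v, w} E} (f : M ⟶ N) (g : N ⟶ P) (x : M.carrier) :
    (f ≫ g) x = g (f x) := rfl

@[simp] lemma id_fn {M : Alg.{u, v, w} E} (x : M.carrier) : (𝟙 M : M ⟶ M) x = x := rfl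

lemma hom_ext {M N : Alg.{u, v, w} E} {f g : M ⟶ N} (h : ∀ x, f x = g x) : f = g :=
  Language.Hom.ext (L := L) (M := M.carrier) (N := N.carrier) h

lemma fn_funMap {M N : Alg.{u, v, w} E} (f : M ⟶ N) {n : ℕ} (c : L.Functions n)
    (x : Fin n → M.carrier) : f (funMap c x) = funMap c (fun i => f (x i)) :=
  Language.Hom.map_fun' (L := L) (M := M.carrier) (N := N.carrier) f c x

lemma congr_fn {M N : Alg.{u, v, w} E} {f g : M ⟶ N} (h : f = g) (x : M.carrier) : f x = g x := by
  rw [h]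

lemma mono_of_injective {M N : Alg.{u, v, w} E} (f : M ⟶ N) (hf : Function.Injective f) : Mono f :=
  ⟨fun _ _ h => hom_ext fun x => hf (congr_fn h x)⟩

lemma epi_of_surjective {M N : Alg.{u, v, w} E} (f : M ⟶ N) (hf : Function.Surjective f) : Epi f :=
  ⟨fun _ _ h => hom_ext fun y => by obtain ⟨x, rfl⟩ := hf y; exact congr_fn h x⟩

lemma injective_of_isIso {M N : Alg.{u, v, w} E} (f : M ⟶ N) [IsIso f] : Function.Injective f :=
  Function.LeftInverse.injective (g := inv f) fun x => by
    rw [← comp_fn, IsIso.hom_inv_id, id_fn]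

lemma surjective_of_isIso {M N : Alg.{u, v, w} E} (f : M ⟶ N) [IsIso f] : Function.Surjective f :=
  Function.RightInverse.surjective (g := inv f) fun x => by
    rw [← comp_fn, IsIso.inv_hom_id, id_fn]

/-- The image of a morphism, as a substructure. -/
def range {M N : Alg.{u, v, w} E} (f : M ⟶ N) : L.Substructure N.carrier where
  carrier := Set.range f
  fun_mem c x hx := by
    choose y hy using hx
    exact ⟨funMap c y, by rw [fn_funMap]; simp only [hy]⟩

variable [L.IsAlgebraic]

/-- A morphism of algebras from a map that commutes with the operations. -/
def homMk {M N : Alg.{u, v, w} E} (f : M.carrier → N.carrier)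
    (hf : ∀ {n : ℕ} (c : L.Functions n) (x : Fin n → M.carrier),
      f (funMap c x) = funMap c (fun i => f (x i))) : M ⟶ N :=
  ({ toFun := f
     map_fun' := fun c x => hf c x
     map_rel' := fun r _ _ => isEmptyElim r } : M.carrier →[L] N.carrier)

@[simp] lemma homMk_fn {M N : Alg.{u, v, w} E} (f : M.carrier → N.carrier)
    (hf : ∀ {n : ℕ} (c : L.Functions n) (x : Fin n → M.carrier),
      f (funMap c x) = funMap c (fun i => f (x i))) (x : M.carrier) : homMk f hf x = f x := rfl

lemma exists_lift {K M Z : Alg.{u, v, w} E} (k : K ⟶ M) (hk : Function.Injective k) (g : Z ⟶ M)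
    (h : ∀ z, ∃ x, k x = g z) : ∃ l : Z ⟶ K, l ≫ k = g := by
  choose l hl using h
  exact ⟨homMk l fun c x => hk (by simp only [fn_funMap, hl]), hom_ext hl⟩

lemma exists_desc {M Q Z : Alg.{u, v, w} E} (e : M ⟶ Q) (he : Function.Surjective e) (g : M ⟶ Z)
    (h : ∀ x y, e x = e y → g x = g y) : ∃ d : Q ⟶ Z, e ≫ d = g := by
  choose s hs using he
  refine ⟨homMk (fun q => g (s q)) fun c x => ?_, hom_ext fun x => h _ _ (hs _)⟩
  rw [← fn_funMap]
  exact h _ _ (by simp only [fn_funMap, hs])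

/-- The algebra on a substructure. -/
def sub (M : Alg.{u, v, w} E) (S : L.Substructure M.carrier) : Alg.{u, v, w} E where
  carrier := S
  sat e he x := Subtype.ext <| by
    have h (t : L.Term ℕ) : ((t.realize x : S) : M.carrier) = t.realize (fun i => (x i).1) :=
      (HomClass.realize_term S.subtype).symm
    rw [h, h]
    exact M.sat e he _

/-- The inclusion of a substructure. -/
def incl (M : Alg.{u, v, w} E) (S : L.Substructure M.carrier) : M.sub S ⟶ M :=
  homMk (fun x : S => x.1) fun _ _ => rfl

@[simp] lemma incl_fn (M : Alg.{u, v, w} E) (S : L.Substructure M.carrier) (x : S) :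
    M.incl S x = x.1 := rfl

lemma incl_injective (M : Alg.{u, v, w} E) (S : L.Substructure M.carrier) :
    Function.Injective (M.incl S) := Subtype.val_injective

/-- The product of two algebras. -/
def prod (M N : Alg.{u, v, w} E) : Alg.{u, v, w} E where
  carrier := M.carrier × N.carrier
  str :=
    { funMap := fun c x => (funMap c fun i => (x i).1, funMap c fun i => (x i).2)
      RelMap := fun r => isEmptyElim r }
  sat e he x := by
    let : L.Structure (M.carrier × N.carrier) :=
      { funMap := fun c x => (funMap c fun i => (x i).1, funMap c fun i => (x i).2)
        RelMap := fun r => isEmptyElim r }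
    have h (t : L.Term ℕ) : (t.realize x : M.carrier × N.carrier) =
        (t.realize fun i => (x i).1, t.realize fun i => (x i).2) := by
      induction t with
      | var => rfl
      | func c ts ih => simp only [Term.realize, ih]; rfl
    rw [h, h, M.sat e he, N.sat e he]

/-- The first projection of a product. -/
def prodFst (M N : Alg.{u, v, w} E) : M.prod N ⟶ M := homMk (fun x => x.1) fun _ _ => rfl

/-- The second projection of a product. -/
def prodSnd (M N : Alg.{u, v, w} E) : M.prod N ⟶ N := homMk (fun x => x.2) fun _ _ => rfl

/-- The elements of a product on which two morphisms agree. -/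
def pullbackSub {M N B : Alg.{u, v, w} E} (f : M ⟶ B) (g : N ⟶ B) :
    L.Substructure (M.prod N).carrier where
  carrier := {x | f x.1 = g x.2}
  fun_mem c x hx := by
    change f (funMap c fun i => (x i).1) = g (funMap c fun i => (x i).2)
    rw [fn_funMap, fn_funMap]
    exact congrArg _ (funext hx)

/-- The concrete pullback of algebras. -/
def pb {M N B : Alg.{u, v, w} E} (f : M ⟶ B) (g : N ⟶ B) : Alg.{u, v, w} E :=
  (M.prod N).sub (pullbackSub f g)

/-- The first projection of a concrete pullback. -/
def pbFst {M N B : Alg.{u, v, w} E} (f : M ⟶ B) (g : N ⟶ B) : pb f g ⟶ M :=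
  incl _ _ ≫ prodFst M N

/-- The second projection of a concrete pullback. -/
def pbSnd {M N B : Alg.{u, v, w} E} (f : M ⟶ B) (g : N ⟶ B) : pb f g ⟶ N :=
  incl _ _ ≫ prodSnd M N

lemma pb_exists {M N B : Alg.{u, v, w} E} (f : M ⟶ B) (g : N ⟶ B) (x : M.carrier) (y : N.carrier)
    (h : f x = g y) : ∃ z, pbFst f g z = x ∧ pbSnd f g z = y :=
  ⟨⟨(x, y), h⟩, rfl, rfl⟩

lemma pb_condition {M N B : Alg.{u, v, w} E} (f : M ⟶ B) (g : N ⟶ B) :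
    pbFst f g ≫ f = pbSnd f g ≫ g := hom_ext fun x => x.2

lemma pb_ext {M N B : Alg.{u, v, w} E} (f : M ⟶ B) (g : N ⟶ B) {x y : (pb f g).carrier}
    (h₁ : pbFst f g x = pbFst f g y) (h₂ : pbSnd f g x = pbSnd f g y) : x = y :=
  Subtype.ext (Prod.ext h₁ h₂)

lemma pb_lift {M N B Z : Alg.{u, v, w} E} (f : M ⟶ B) (g : N ⟶ B) (a : Z ⟶ M) (b : Z ⟶ N)
    (h : a ≫ f = b ≫ g) : ∃ l : Z ⟶ pb f g, l ≫ pbFst f g = a ∧ l ≫ pbSnd f g = b :=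
  ⟨homMk (fun z => ⟨(a z, b z), congr_fn h z⟩) fun c x => Subtype.ext
    (Prod.ext (fn_funMap a c x) (fn_funMap b c x)), rfl, rfl⟩

lemma exists_diagonal {M N : Alg.{u, v, w} E} (f : M ⟶ N) :
    ∃ d : M ⟶ pb f f, d ≫ pbFst f f = 𝟙 M ∧ d ≫ pbSnd f f = 𝟙 M := pb_lift f f _ _ rfl

lemma pb_isPullback {M N B : Alg.{u, v, w} E} (f : M ⟶ B) (g : N ⟶ B) :
    IsPullback (pbFst f g) (pbSnd f g) f g :=
  ⟨⟨pb_condition f g⟩, ⟨PullbackCone.IsLimit.mk _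
    (fun s => (pb_lift f g s.fst s.snd s.condition).choose)
    (fun s => (pb_lift f g s.fst s.snd s.condition).choose_spec.1)
    (fun s => (pb_lift f g s.fst s.snd s.condition).choose_spec.2)
    (fun s m h₁ h₂ => by
      have h := (pb_lift f g s.fst s.snd s.condition).choose_spec
      refine hom_ext fun z => pb_ext f g ?_ ?_
      · rw [← comp_fn, ← comp_fn, h₁, h.1]
      · rw [← comp_fn, ← comp_fn, h₂, h.2])⟩⟩

end Alg

section IsPullback

variable [L.IsAlgebraic] {W M N B : Alg.{u, v, w} E} {p₁ : W ⟶ M} {p₂ : W ⟶ N} {f : M ⟶ B}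
  {g : N ⟶ B}

lemma Alg.exists_of_isPullback (h : IsPullback p₁ p₂ f g) (x : M.carrier) (y : N.carrier)
    (hxy : f x = g y) : ∃ z, p₁ z = x ∧ p₂ z = y := by
  obtain ⟨z, rfl, rfl⟩ := pb_exists f g x y hxy
  refine ⟨h.lift (pbFst f g) (pbSnd f g) (pb_condition f g) z, ?_, ?_⟩
  · rw [← comp_fn, h.lift_fst]
  · rw [← comp_fn, h.lift_snd]

lemma Alg.ext_of_isPullback (h : IsPullback p₁ p₂ f g) {x y : W.carrier} (h₁ : p₁ x = p₁ y)
    (h₂ : p₂ x = p₂ y) : x = y := by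
  let i := (h.isoIsPullback _ _ (pb_isPullback f g)).hom
  refine injective_of_isIso i (pb_ext f g ?_ ?_)
  · rw [← comp_fn, ← comp_fn, IsPullback.isoIsPullback_hom_fst, h₁]
  · rw [← comp_fn, ← comp_fn, IsPullback.isoIsPullback_hom_snd, h₂]

end IsPullback

namespace Alg

variable [L.IsAlgebraic]

/-- The algebra of equivalence classes for a congruence relation. -/
def quot (M : Alg.{u, v, w} E) (s : Setoid M.carrier)
    (hs : ∀ {n : ℕ} (c : L.Functions n) (x y : Fin n → M.carrier), (∀ i, s (x i) (y i)) →
      s (funMap c x) (funMap c y)) : Alg.{u, v, w} E :=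
  letI : L.Prestructure s :=
    { toStructure := M.str
      fun_equiv := fun x y h => hs _ x y h
      rel_equiv := fun {_ r} _ _ _ => isEmptyElim r }
  { carrier := Quotient s
    sat := fun e he x => by
      have h : x = fun i => (Quotient.mk s (x i).out) := funext fun i => (Quotient.out_eq _).symm
      rw [h, Term.realize_quotient_mk', Term.realize_quotient_mk', M.sat e he] }

/-- The projection onto the quotient by a congruence relation. -/
def quotMk (M : Alg.{u, v, w} E) (s : Setoid M.carrier)
    (hs : ∀ {n : ℕ} (c : L.Functions n) (x y : Fin n → M.carrier), (∀ i, s (x i) (y i)) →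
      s (funMap c x) (funMap c y)) : M ⟶ M.quot s hs :=
  homMk (fun x => Quotient.mk s x) fun c x => by
    let : L.Prestructure s :=
      { toStructure := M.str
        fun_equiv := fun x y h => hs _ x y h
        rel_equiv := fun {_ r} _ _ _ => isEmptyElim r }
    exact (funMap_quotient_mk' s c x).symm

lemma quotMk_surjective (M : Alg.{u, v, w} E) (s : Setoid M.carrier)
    (hs : ∀ {n : ℕ} (c : L.Functions n) (x y : Fin n → M.carrier), (∀ i, s (x i) (y i)) →
      s (funMap c x) (funMap c y)) : Function.Surjective (M.quotMk s hs) :=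
  Quotient.mk_surjective

lemma quotMk_eq_iff (M : Alg.{u, v, w} E) (s : Setoid M.carrier)
    (hs : ∀ {n : ℕ} (c : L.Functions n) (x y : Fin n → M.carrier), (∀ i, s (x i) (y i)) →
      s (funMap c x) (funMap c y)) (x y : M.carrier) :
    M.quotMk s hs x = M.quotMk s hs y ↔ s x y := Quotient.eq

/-- The one-element algebra. -/
def trivial : Alg.{u, v, w} E where
  carrier := PUnit
  str := { funMap := fun _ _ => PUnit.unit, RelMap := fun r => isEmptyElim r }
  sat _ _ _ := rfl

/-- The morphism to the one-element algebra. -/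
def toTrivial (M : Alg.{u, v, w} E) : M ⟶ trivial (E := E) :=
  homMk (fun _ => PUnit.unit) fun _ _ => rfl

end Alg

end Algebras

/-! ### Kernels and cokernels in a pointed variety. -/

section Pointed

open FirstOrder FirstOrder.Language FirstOrder.Language.Structure

variable {L : FirstOrder.Language.{u, v}} {E : Set (L.Term ℕ × L.Term ℕ)} [L.IsAlgebraic]
  [HasZeroMorphisms (Alg.{u, v, w} E)]

namespace Alg

/-- The base point of an algebra in a pointed variety. -/
def pt (M : Alg.{u, v, w} E) : M.carrier := (0 : trivial (E := E) ⟶ M) PUnit.unit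

-- The zero morphism factors through the one-element algebra.
@[simp] lemma zero_fn {M N : Alg.{u, v, w} E} (x : M.carrier) : (0 : M ⟶ N) x = N.pt := by
  rw [← comp_zero (f := toTrivial M)]
  rfl

@[simp] lemma fn_pt {M N : Alg.{u, v, w} E} (f : M ⟶ N) : f M.pt = N.pt := by
  rw [← zero_fn (M := M) M.pt, ← comp_fn, zero_comp, zero_fn]

lemma eq_zero_iff {M N : Alg.{u, v, w} E} (f : M ⟶ N) : f = 0 ↔ ∀ x, f x = N.pt :=
  ⟨fun h x => by rw [h, zero_fn], fun h => hom_ext fun x => by rw [h, zero_fn]⟩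

lemma fn_fn_eq_pt {K M N : Alg.{u, v, w} E} {k : K ⟶ M} {f : M ⟶ N} (h : k ≫ f = 0)
    (x : K.carrier) : f (k x) = N.pt := (eq_zero_iff _).1 h x

/-- The kernel of a morphism, as a substructure. -/
def kerSub {M N : Alg.{u, v, w} E} (f : M ⟶ N) : L.Substructure M.carrier where
  carrier := {x | f x = N.pt}
  fun_mem c x hx := by
    have h (i) : f (x i) = (0 : M ⟶ N) (x i) := by rw [zero_fn]; exact hx i
    change f (funMap c x) = _
    rw [fn_funMap, funext h, ← fn_funMap, zero_fn]

lemma nonempty_isLimit_kernelFork {K M N : Alg.{u, v, w} E} (k : K ⟶ M) (f : M ⟶ N)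
    (h : k ≫ f = 0) (hk : Function.Injective k) (hf : ∀ x, f x = N.pt → ∃ z, k z = x) :
    Nonempty (IsLimit (KernelFork.ofι k h)) := by
  have := mono_of_injective k hk
  have H {Z : Alg.{u, v, w} E} (g : Z ⟶ M) (hg : g ≫ f = 0) :=
    exists_lift k hk g fun z => hf _ (fn_fn_eq_pt hg z)
  exact ⟨KernelFork.IsLimit.ofι' k h fun g hg => ⟨(H g hg).choose, (H g hg).choose_spec⟩⟩

lemma exists_of_isLimit_kernelFork {K M N : Alg.{u, v, w} E} {k : K ⟶ M} {f : M ⟶ N}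
    {h : k ≫ f = 0} (hl : IsLimit (KernelFork.ofι k h)) (x : M.carrier) (hx : f x = N.pt) :
    ∃ z, k z = x := by
  obtain ⟨l, hl⟩ := KernelFork.IsLimit.lift' hl (M.incl (kerSub f)) ((eq_zero_iff _).2 fun z => z.2)
  exact ⟨l ⟨x, hx⟩, congr_fn hl ⟨x, hx⟩⟩

/-- Kernels are monomorphisms, and the two projections of the concrete kernel pair of a monomorphism
coincide. -/
lemma injective_of_isLimit_kernelFork {K M N : Alg.{u, v, w} E} {k : K ⟶ M} {f : M ⟶ N}
    {h : k ≫ f = 0} (hl : IsLimit (KernelFork.ofι k h)) : Function.Injective k := by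
  intro x y hxy
  have : Mono k := mono_of_isLimit_fork hl
  have h : pbFst k k = pbSnd k k := by
    rw [← cancel_mono k, pb_condition]
  obtain ⟨z, rfl, rfl⟩ := pb_exists k k x y hxy
  exact congr_fn h z

/-- The corestriction of `f` to its image kills `k`, so it descends to `N` and yields a section of
the inclusion of the image. -/
lemma surjective_of_isColimit_cokernelCofork {M N K : Alg.{u, v, w} E} {k : K ⟶ M} {f : M ⟶ N}
    {h : k ≫ f = 0} (hl : IsColimit (CokernelCofork.ofπ f h)) : Function.Surjective f := by
  obtain ⟨g, hg⟩ := exists_lift (N.incl (range f)) (incl_injective _ _) f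
    fun z => ⟨⟨f z, z, rfl⟩, rfl⟩
  obtain ⟨d, hd⟩ := CokernelCofork.IsColimit.desc' hl g (by
    have := mono_of_injective _ (incl_injective N (range f))
    rw [← cancel_mono (N.incl (range f)), Category.assoc, hg, h, zero_comp])
  have : Epi f := epi_of_isColimit_cofork hl
  have hd' : f ≫ d = g := hd
  have h : d ≫ N.incl (range f) = 𝟙 N := by
    rw [← cancel_epi f, ← Category.assoc, hd', hg, Category.comp_id]
  intro y
  obtain ⟨x, hx⟩ := (d y).2
  exact ⟨x, hx.trans (congr_fn h y)⟩

end Alg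

end Pointed

/-! ### Elementwise consequences of the Split Short Five Lemma. -/

section Protomodular

open FirstOrder FirstOrder.Language FirstOrder.Language.Structure

variable {L : FirstOrder.Language.{u, v}} {E : Set (L.Term ℕ × L.Term ℕ)} [L.IsAlgebraic]
  [HasZeroMorphisms (Alg.{u, v, w} E)]

namespace Alg

/-- The restriction of `f` to `S` is split by `s` and has the same kernel as `f`, so the Split Short
Five Lemma makes the inclusion of `S` an isomorphism. -/
lemma eq_top_of_section (hC : SplitShortFiveLemma (Alg.{u, v, w} E)) {M N : Alg.{u, v, w} E}
    (f : M ⟶ N) (s : N ⟶ M) (hs : s ≫ f = 𝟙 N) (S : L.Substructure M.carrier)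
    (hker : ∀ x, f x = N.pt → x ∈ S) (hsec : ∀ y, s y ∈ S) (x : M.carrier) : x ∈ S := by
  obtain ⟨s', hs'⟩ := exists_lift (M.incl S) (incl_injective _ _) s fun y => ⟨⟨s y, hsec y⟩, rfl⟩
  let k := M.incl (kerSub f)
  have hk : k ≫ f = 0 := (eq_zero_iff _).2 fun z => z.2
  obtain ⟨k', hk'⟩ := exists_lift (M.incl S) (incl_injective _ _) k
    fun z => ⟨⟨z.1, hker _ z.2⟩, rfl⟩
  have hk'f : k' ≫ M.incl S ≫ f = 0 := by rw [← Category.assoc, hk', hk]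
  have := hC k' (M.incl S ≫ f) s' k f s hk'f hk (𝟙 _) (M.incl S) (𝟙 _)
    (nonempty_isLimit_kernelFork _ _ _
      (fun x y h => incl_injective _ _ (by
        have h' := congrArg (M.incl S) h
        rwa [← comp_fn, ← comp_fn, hk'] at h'))
      (fun x hx => ⟨⟨x.1, hx⟩, incl_injective _ _ (congr_fn hk' _)⟩))
    (nonempty_isLimit_kernelFork _ _ _ (incl_injective _ _) (fun x hx => ⟨⟨x, hx⟩, rfl⟩))
    (by rw [← Category.assoc, hs', hs]) hs (by rw [hk', Category.id_comp]) (by simp)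
    (by rw [hs', Category.id_comp]) inferInstance inferInstance
  obtain ⟨z, rfl⟩ := surjective_of_isIso (M.incl S) x
  exact z.2

/-- In the kernel pair of `f`, the pairs on which `g` agrees form a subalgebra. It contains the
diagonal, which splits the first projection, and the kernel of that projection, so it is everything.
-/
lemma eq_of_ker (hC : SplitShortFiveLemma (Alg.{u, v, w} E)) {M N Z : Alg.{u, v, w} E}
    (f : M ⟶ N) (g : M ⟶ Z) (hker : ∀ x, f x = N.pt → g x = Z.pt) {x y : M.carrier}
    (hxy : f x = f y) : g x = g y := by
  obtain ⟨d, hd₁, hd₂⟩ := exists_diagonal f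
  let S : L.Substructure (pb f f).carrier :=
    { carrier := {z | g (pbFst f f z) = g (pbSnd f f z)}
      fun_mem := fun c z hz => by
        change g (pbFst f f (funMap c z)) = g (pbSnd f f (funMap c z))
        simp only [fn_funMap]
        exact congrArg _ (funext hz) }
  obtain ⟨z, rfl, rfl⟩ := pb_exists f f x y hxy
  refine eq_top_of_section hC (pbFst f f) d hd₁ S (fun z hz => ?_) (fun x => ?_) z
  · change g (pbFst f f z) = g (pbSnd f f z)
    rw [hz, fn_pt, hker]
    rw [← comp_fn, ← pb_condition, comp_fn, hz, fn_pt]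
  · change g (pbFst f f (d x)) = g (pbSnd f f (d x))
    rw [← comp_fn d (pbFst f f), hd₁, ← comp_fn d (pbSnd f f), hd₂]

/-- The same principle on the pullback of `t ≫ f` and `f`, whose first projection is split by `(𝟙,
t)`: the pairs with second entry in the image of `t` form the subalgebra. -/
lemma surjective_of_ker (hC : SplitShortFiveLemma (Alg.{u, v, w} E)) {T M N : Alg.{u, v, w} E}
    (t : T ⟶ M) (f : M ⟶ N) (hker : ∀ x, f x = N.pt → ∃ z, t z = x)
    (htf : Function.Surjective (t ≫ f)) : Function.Surjective t := by
  intro x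
  obtain ⟨z, hz⟩ := htf (f x)
  obtain ⟨s, hs₁, hs₂⟩ := pb_lift (t ≫ f) f (𝟙 T) t (Category.id_comp _)
  let S : L.Substructure (pb (t ≫ f) f).carrier :=
    { carrier := {y | pbSnd (t ≫ f) f y ∈ range t}
      fun_mem := fun c y hy => by
        change pbSnd (t ≫ f) f (funMap c y) ∈ range t
        rw [fn_funMap]
        exact (range t).fun_mem c _ hy }
  obtain ⟨y, -, rfl⟩ := pb_exists (t ≫ f) f z x hz
  refine eq_top_of_section hC (pbFst _ _) s hs₁ S (fun y hy => ?_) (fun z => ?_) y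
  · refine hker _ ?_
    rw [← comp_fn, ← pb_condition, comp_fn, hy, fn_pt]
  · exact ⟨z, (congr_fn hs₂ z).symm⟩

lemma nonempty_isColimit_cokernelCofork (hC : SplitShortFiveLemma (Alg.{u, v, w} E))
    {K M N : Alg.{u, v, w} E} (k : K ⟶ M) (f : M ⟶ N) (h : k ≫ f = 0)
    (hf : Function.Surjective f) (hk : ∀ x, f x = N.pt → ∃ z, k z = x) :
    Nonempty (IsColimit (CokernelCofork.ofπ f h)) := by
  have := epi_of_surjective f hf
  have H {Z : Alg.{u, v, w} E} (g : M ⟶ Z) (hg : k ≫ g = 0) :=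
    exists_desc f hf g fun x y hxy => eq_of_ker hC f g (fun x hx => by
      obtain ⟨z, rfl⟩ := hk x hx
      exact fn_fn_eq_pt hg z) hxy
  exact ⟨CokernelCofork.IsColimit.ofπ' f h fun g hg => ⟨(H g hg).choose, (H g hg).choose_spec⟩⟩

/-- Surjectivity suffices for the cokernel half, since by `eq_of_ker` a morphism that kills the
kernel is constant on fibres. -/
lemma isExtension_iff (hC : SplitShortFiveLemma (Alg.{u, v, w} E))
    (S : ShortComplex (Alg.{u, v, w} E)) :
    IsExtension S ↔ Function.Injective S.f ∧ (∀ x, S.g x = S.X₃.pt → ∃ z, S.f z = x) ∧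
      Function.Surjective S.g := by
  refine ⟨fun ⟨⟨h₁⟩, ⟨h₂⟩⟩ => ⟨injective_of_isLimit_kernelFork h₁, exists_of_isLimit_kernelFork h₁,
    surjective_of_isColimit_cokernelCofork h₂⟩, fun ⟨h₁, h₂, h₃⟩ =>
    ⟨nonempty_isLimit_kernelFork _ _ _ h₁ h₂, nonempty_isColimit_cokernelCofork hC _ _ _ h₃ h₂⟩⟩

/-- A pullback of an extension is an extension. -/
lemma isExtension_of_isPullback (hC : SplitShortFiveLemma (Alg.{u, v, w} E))
    {S' S : ShortComplex (Alg.{u, v, w} E)} (φ : S' ⟶ S) (hS : IsExtension S) [IsIso φ.τ₁]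
    (h : IsPullback φ.τ₂ S'.g S.g φ.τ₃) : IsExtension S' := by
  rw [isExtension_iff hC] at hS ⊢
  obtain ⟨h₁, h₂, h₃⟩ := hS
  refine ⟨fun x y hxy => ?_, fun x hx => ?_, fun y => ?_⟩
  · refine injective_of_isIso φ.τ₁ (h₁ ?_)
    rw [← comp_fn, ← comp_fn, φ.comm₁₂, comp_fn, comp_fn, hxy]
  · obtain ⟨z, hz⟩ := h₂ (φ.τ₂ x) (by rw [← comp_fn, h.w, comp_fn, hx, fn_pt])
    obtain ⟨z, rfl⟩ := surjective_of_isIso φ.τ₁ z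
    refine ⟨z, ext_of_isPullback h ?_ ?_⟩
    · rw [← hz, ← comp_fn, ← comp_fn, φ.comm₁₂]
    · rw [hx, fn_fn_eq_pt S'.zero]
  · obtain ⟨x, hx⟩ := h₃ (φ.τ₃ y)
    obtain ⟨z, -, hz⟩ := exists_of_isPullback h x y hx
    exact ⟨z, hz⟩

end Alg

end Protomodular

end SemiAb

namespace SemiAb

/-! ### Reflective subcategories and local equivalences. -/

section Reflection

variable {C : Type u} [Category.{v} C] (P : ObjectProperty C)

lemma mem_range_ι_obj : (· ∈ Set.range P.ι.obj) = P := by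
  ext X
  exact ⟨by rintro ⟨Y, rfl⟩; exact Y.property, fun hX => ⟨⟨X, hX⟩, rfl⟩⟩

variable [Reflective P.ι]

/-- The components of the coaugmentation. -/
def coaug (X : C) : X ⟶ (localization P).obj X := (coaugmentation P).app X

lemma localization_prop (X : C) : P ((localization P).obj X) := ((reflector P.ι).obj X).property

/-- Trades invertibility after localization for bijectivity of precomposition on morphisms into
objects of `P`, the form used below. -/
lemma equivalences_localization : equivalences (localization P) = P.isLocal := by
  ext X Y f
  have h := ObjectProperty.isLocal_iff_isIso_map (reflectorAdjunction P.ι) f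
  rw [mem_range_ι_obj] at h
  rw [h]
  exact isIso_iff_of_reflects_iso ((reflector P.ι).map f) P.ι

lemma isLocal_coaug (X : C) : P.isLocal (coaug P X) := by
  have h := ObjectProperty.isLocal_adj_unit_app (reflectorAdjunction P.ι) X
  rwa [mem_range_ι_obj] at h

variable {P}

lemma coaug_desc {X Z : C} (hZ : P Z) (g : X ⟶ Z) :
    ∃ d, coaug P X ≫ d = g := (isLocal_coaug P X Z hZ).2 g

lemma coaug_cancel {X Z : C} (hZ : P Z) {d d' : (localization P).obj X ⟶ Z}
    (h : coaug P X ≫ d = coaug P X ≫ d') : d = d' :=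
  (isLocal_coaug P X Z hZ).1 h

lemma coaug_naturality {X Y : C} (f : X ⟶ Y) :
    coaug P X ≫ (localization P).map f = f ≫ coaug P Y :=
  ((coaugmentation P).naturality f).symm

lemma coaug_naturality_assoc {X Y Z : C} (f : X ⟶ Y) (g : (localization P).obj Y ⟶ Z) :
    coaug P X ≫ (localization P).map f ≫ g = f ≫ coaug P Y ≫ g := by
  rw [← Category.assoc, coaug_naturality, Category.assoc]

lemma isIso_localization_map {X Y : C} {f : X ⟶ Y} (hf : P.isLocal f) :
    IsIso ((localization P).map f) := by
  rw [← equivalences_localization] at hf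
  exact hf

variable (P) in
/-- The pullback of a coaugmentation `Y ⟶ localization P Y` along a morphism from an object
satisfying `P` is inverted by the localization. -/
def PullsBackCoaug : Prop :=
  ∀ ⦃W Y Z : C⦄ (p₁ : W ⟶ Y) (p₂ : W ⟶ Z) (g : Z ⟶ (localization P).obj Y), P Z →
    IsPullback p₁ p₂ (coaug P Y) g → P.isLocal p₂

/-- Two opposite sides of the image square become isomorphisms, so it is a pullback. -/
lemma PullsBackCoaug.semiLeftExact (H : PullsBackCoaug P) : SemiLeftExact P := by
  intro W Y X p₁ p₂ g h
  have h₁ : IsIso ((reflector P.ι).map p₂) := by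
    have : IsIso (P.ι.map ((reflector P.ι).map p₂)) :=
      isIso_localization_map (H p₁ p₂ _ X.property h)
    exact isIso_of_reflects_iso _ P.ι
  have h₂ : IsIso ((reflector P.ι).map ((reflectorAdjunction P.ι).unit.app Y)) := by
    have : IsIso (P.ι.map ((reflector P.ι).map ((reflectorAdjunction P.ι).unit.app Y))) :=
      isIso_localization_map (isLocal_coaug P Y)
    exact isIso_of_reflects_iso _ P.ι
  exact IsPullback.of_vert_isIso ⟨by rw [← Functor.map_comp, h.w, Functor.map_comp]⟩

end Reflection

/-! ### Unique right lifting. -/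

section Orthogonal

variable {C : Type u} [Category.{v} C] {P : ObjectProperty C}

lemma rightOrthogonal_of_prop {X Y : C} (p : X ⟶ Y) (hX : P X) (hY : P Y) :
    rightOrthogonal P.isLocal p := by
  intro A B f hf a b w
  obtain ⟨l, hl⟩ := (hf X hX).2 a
  refine ⟨l, ⟨hl, (hf Y hY).1 ?_⟩, fun l' hl' => (hf X hX).1 (hl'.1.trans hl.symm)⟩
  change f ≫ l = a at hl
  change f ≫ l ≫ p = f ≫ b
  rw [← w, ← hl, Category.assoc]

variable {W : MorphismProperty C}

lemma rightOrthogonal_of_isPullback {T X Y Z : C} {t : T ⟶ X} {l : T ⟶ Y} {p : X ⟶ Z} {r : Y ⟶ Z}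
    (h : IsPullback t l p r) (hp : rightOrthogonal W p) : rightOrthogonal W l := by
  intro A B f hf a b w
  obtain ⟨m, ⟨hm₁, hm₂⟩, hm⟩ := hp f hf (a ≫ t) (b ≫ r) (by
    rw [Category.assoc, h.w, ← Category.assoc, w, Category.assoc])
  refine ⟨h.lift m b hm₂, ⟨h.hom_ext ?_ ?_, h.lift_snd _ _ _⟩, ?_⟩
  · rw [Category.assoc, h.lift_fst, hm₁]
  · rw [Category.assoc, h.lift_snd, w]
  · rintro n ⟨hn₁, hn₂⟩
    refine h.hom_ext ?_ (by rw [h.lift_snd, hn₂])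
    rw [h.lift_fst]
    refine hm _ ⟨by rw [← Category.assoc, hn₁], by rw [Category.assoc, h.w, ← hn₂, Category.assoc]⟩

/-- Lifting `𝟙 X` against `i ≫ q` gives a left inverse `l ≫ i`-compatible with `q`; uniqueness of
lifts against `q` makes it two-sided. -/
lemma isIso_of_rightOrthogonal {X Z Y : C} {i : X ⟶ Z} {q : Z ⟶ Y} (hi : W i)
    (hq : rightOrthogonal W q) (hp : rightOrthogonal W (i ≫ q)) : IsIso i := by
  obtain ⟨l, ⟨hl₁, hl₂⟩, -⟩ := hp i hi (𝟙 X) q (Category.id_comp _)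
  refine ⟨l, hl₁, (hq i hi i q rfl).unique ⟨?_, ?_⟩ ⟨Category.comp_id _, Category.id_comp _⟩⟩
  · rw [← Category.assoc, hl₁, Category.id_comp]
  · rw [Category.assoc, hl₂]

lemma rightOrthogonal_of_isIso {X Y : C} (p : X ⟶ Y) [IsIso p] : rightOrthogonal W p := by
  intro A B f _ a b w
  refine ⟨b ≫ inv p, ⟨?_, by simp⟩, ?_⟩
  · rw [← Category.assoc, ← w, Category.assoc, IsIso.hom_inv_id, Category.comp_id]
  · rintro l ⟨-, rfl⟩
    simp

lemma hasLiftingProperty_of_rightOrthogonal {A B X Y : C} {f : A ⟶ B} {p : X ⟶ Y} (hf : W f)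
    (hp : rightOrthogonal W p) : HasLiftingProperty f p :=
  ⟨fun {a b} sq => by
    obtain ⟨l, ⟨hl₁, hl₂⟩, -⟩ := hp f hf a b sq.w
    exact ⟨⟨⟨l, hl₁, hl₂⟩⟩⟩⟩

instance rightOrthogonal_isStableUnderRetracts :
    (rightOrthogonal W).IsStableUnderRetracts where
  of_retract {X Y Z V p q} h hq A B f hf a b w := by
    have hw : (a ≫ h.i.left) ≫ q = f ≫ b ≫ h.i.right := by
      rw [Category.assoc, ← Category.assoc f, ← w, Category.assoc]
      exact congrArg (a ≫ ·) h.i.w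
    obtain ⟨l, ⟨hl₁, hl₂⟩, hl⟩ := hq f hf (a ≫ h.i.left) (b ≫ h.i.right) hw
    have hr₁ : h.i.left ≫ h.r.left = 𝟙 X := congrArg CommaMorphism.left h.retract
    have hr₂ : h.i.right ≫ h.r.right = 𝟙 Y := congrArg CommaMorphism.right h.retract
    have hw₁ : h.i.left ≫ q = p ≫ h.i.right := h.i.w
    have hw₂ : h.r.left ≫ p = q ≫ h.r.right := h.r.w
    refine ⟨l ≫ h.r.left, ⟨?_, ?_⟩, ?_⟩
    · rw [← Category.assoc, hl₁, Category.assoc, hr₁, Category.comp_id]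
    · rw [Category.assoc, hw₂, ← Category.assoc, hl₂, Category.assoc, hr₂, Category.comp_id]
    · rintro n ⟨hn₁, hn₂⟩
      rw [← hl (n ≫ h.i.left) ⟨by rw [← Category.assoc, hn₁], by
        rw [Category.assoc, hw₁, ← Category.assoc, hn₂]⟩, Category.assoc, hr₁, Category.comp_id]

end Orthogonal

/-! ### The local model structure and right properness. -/

section LocalModelStructure

variable {C : Type u} [Category.{v} C] {P : ObjectProperty C} [Reflective P.ι]

/-- The middle object is the pullback of the localized morphism along the unit of `Y`. Its
projection `r` is a pulled back unit, hence local, and two-out-of-three applied to `i ≫ r` makes `i`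
local. -/
lemma PullsBackCoaug.exists_factorization [HasPullbacks C]
    (H : PullsBackCoaug P) {X Y : C} (f : X ⟶ Y) :
    ∃ (Z : C) (i : X ⟶ Z) (q : Z ⟶ Y) (r : Z ⟶ (localization P).obj X), i ≫ q = f ∧
      P.isLocal i ∧ rightOrthogonal P.isLocal q ∧ i ≫ r = coaug P X ∧
        IsPullback r q ((localization P).map f) (coaug P Y) := by
  have h := IsPullback.of_hasPullback ((localization P).map f) (coaug P Y)
  refine ⟨_, h.lift (coaug P X) f (coaug_naturality f), _, _,
    h.lift_snd _ _ _, ?_, rightOrthogonal_of_isPullback h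
    (rightOrthogonal_of_prop _ (localization_prop P _) (localization_prop P _)),
    h.lift_fst _ _ _, h⟩
  refine P.isLocal.of_postcomp _ _ (H _ _ _ (localization_prop P _) h.flip) ?_
  rw [h.lift_fst]
  exact isLocal_coaug P X

/-- The first factor of the factorization of an orthogonal morphism is invertible. -/
lemma PullsBackCoaug.isPullback_of_rightOrthogonal [HasPullbacks C]
    (H : PullsBackCoaug P) {X Y : C} (f : X ⟶ Y) (hf : rightOrthogonal P.isLocal f) :
    IsPullback (coaug P X) f ((localization P).map f)
      (coaug P Y) := by
  obtain ⟨Z, i, q, r, rfl, hi, hq, hr, h⟩ := H.exists_factorization f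
  have := isIso_of_rightOrthogonal hi hq hf
  exact h.of_iso (asIso i).symm (Iso.refl _) (Iso.refl _) (Iso.refl _) (by simp [← hr]) (by simp)
    (by simp) (by simp)

/-- Pasting exhibits `T` as a pullback over the localization of `B`. Since `r` is inverted there, `t
≫ coaug P Y` is the pullback of the unit of `X` along a morphism from an object of `P`;
two-out-of-three concludes. -/
lemma PullsBackCoaug.isLocal_of_isPullback [HasPullbacks C]
    (H : PullsBackCoaug P) {T X Y B : C} {t : T ⟶ Y} {l : T ⟶ X} {p : Y ⟶ B} {r : X ⟶ B}
    (h : IsPullback t l p r) (hp : rightOrthogonal P.isLocal p) (hr : P.isLocal r) :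
    P.isLocal t := by
  have := isIso_localization_map hr
  have h₁ := h.paste_horiz (H.isPullback_of_rightOrthogonal p hp)
  rw [← coaug_naturality r] at h₁
  have h₂ : IsPullback (𝟙 _) ((localization P).map p ≫ inv ((localization P).map r))
      ((localization P).map p) ((localization P).map r) := IsPullback.of_horiz_isIso ⟨by simp⟩
  rw [← Category.comp_id (t ≫ _)] at h₁
  have h₃ := h₁.of_right (by
    rw [← cancel_mono ((localization P).map r)]
    simpa using h₁.w) h₂
  exact P.isLocal.of_postcomp _ _ (isLocal_coaug P Y)
    (H _ _ _ (localization_prop P _) h₃.flip)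

/-- The local model structure. -/
@[reducible]
def PullsBackCoaug.modelCategory [HasFiniteLimits C] [HasFiniteColimits C]
    (H : PullsBackCoaug P) : ModelCategory C :=
  letI cw : CategoryWithWeakEquivalences C := ⟨equivalences (localization P)⟩
  letI cc : CategoryWithCofibrations C := ⟨⊤⟩
  letI cf : CategoryWithFibrations C := ⟨rightOrthogonal (equivalences (localization P))⟩
  have hW : weakEquivalences C = P.isLocal := equivalences_localization P
  have hF : fibrations C = rightOrthogonal P.isLocal :=
    congrArg rightOrthogonal (equivalences_localization P)
  { categoryWithFibrations := cf
    categoryWithCofibrations := cc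
    categoryWithWeakEquivalences := cw
    cm2 := by rw [hW]; infer_instance
    cm3a := inferInstanceAs
      (((MorphismProperty.isomorphisms C).inverseImage (localization P)).IsStableUnderRetracts)
    cm3b := by rw [hF]; infer_instance
    cm3c := ⟨fun _ _ => trivial⟩
    cm4a := fun i p _ hi hp => hasLiftingProperty_of_rightOrthogonal hi.mem hp.mem
    -- A trivial fibration is orthogonal to itself, hence an isomorphism.
    cm4b := fun i p _ hp hp' => by
      have : IsIso p := isIso_of_rightOrthogonal hp'.mem (rightOrthogonal_of_isIso (𝟙 _))
        (by rw [Category.comp_id]; exact hp.mem)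
      infer_instance
    cm5a := ⟨fun f => by
      obtain ⟨Z, i, q, r, hf, hi, hq, -, -⟩ := H.exists_factorization f
      exact ⟨⟨Z, i, q, hf, ⟨trivial, by rwa [hW]⟩, by rwa [hF]⟩⟩⟩
    cm5b := ⟨fun {X Y} f => ⟨⟨Y, f, 𝟙 Y, Category.comp_id f, trivial,
      ⟨rightOrthogonal_of_isIso _, by rw [hW]; exact ObjectProperty.isLocal_of_isIso _ _⟩⟩⟩⟩ }

lemma PullsBackCoaug.exists_modelCategory [HasFiniteLimits C] [HasFiniteColimits C]
    (H : PullsBackCoaug P) :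
    ∃ M : ModelCategory C, IsLocalModelStructure (localization P) M ∧ RightProper M := by
  refine ⟨H.modelCategory, ⟨rfl, rfl, rfl⟩, fun P' Y X B t l p r h hp hr => ?_⟩
  change rightOrthogonal (equivalences (localization P)) p at hp
  change equivalences (localization P) r at hr
  change equivalences (localization P) t
  rw [equivalences_localization] at hp hr ⊢
  exact H.isLocal_of_isPullback h hp hr

end LocalModelStructure

end SemiAb

namespace SemiAb

/-! ### Null objects, null covers and conditional flatness. -/

section Nullification

open FirstOrder.Language.Structure Alg

variable {L : FirstOrder.Language.{u, v}} {E : Set (L.Term ℕ × L.Term ℕ)}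
  [HasZeroMorphisms (Alg.{u, v, w} E)] {A : Alg.{u, v, w} E}

lemma nullObjects_of_isPullback {W X Y Z : Alg.{u, v, w} E} {p₁ : W ⟶ X} {p₂ : W ⟶ Y} {f : X ⟶ Z}
    {g : Y ⟶ Z} (h : IsPullback p₁ p₂ f g) (hX : nullObjects A X) (hY : nullObjects A Y) :
    nullObjects A W := fun a =>
  h.hom_ext (by rw [hX (a ≫ p₁), zero_comp]) (by rw [hY (a ≫ p₂), zero_comp])

lemma nullObjects_of_isExtension {S : ShortComplex (Alg.{u, v, w} E)} (hS : IsExtension S)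
    (h₁ : nullObjects A S.X₁) (h₃ : nullObjects A S.X₃) : nullObjects A S.X₂ := fun a => by
  obtain ⟨l, hl⟩ := KernelFork.IsLimit.lift' hS.isKernel.some a (h₃ _)
  rw [← hl, h₁ l, zero_comp]

variable (A) in
/-- The congruence relation that defines the largest null quotient. -/
def nullSetoid (X : Alg.{u, v, w} E) : Setoid X.carrier where
  r x y := ∀ Z, nullObjects A Z → ∀ g : X ⟶ Z, g x = g y
  iseqv := ⟨fun _ _ _ _ => rfl, fun h Z hZ g => (h Z hZ g).symm,
    fun h h' Z hZ g => (h Z hZ g).trans (h' Z hZ g)⟩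

lemma nullSetoid_funMap (X : Alg.{u, v, w} E) {n : ℕ} (c : L.Functions n) (x y : Fin n → X.carrier)
    (h : ∀ i, nullSetoid A X (x i) (y i)) : nullSetoid A X (funMap c x) (funMap c y) :=
  fun Z hZ g => by
    rw [fn_funMap, fn_funMap]
    exact congrArg _ (funext fun i => h i Z hZ g)

variable [L.IsAlgebraic]

variable (A) in
/-- The largest null quotient of an algebra. -/
def nullQuot (X : Alg.{u, v, w} E) : Alg.{u, v, w} E :=
  X.quot (nullSetoid A X) (nullSetoid_funMap X)

variable (A) in
/-- The projection to the largest null quotient. -/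
def nullMk (X : Alg.{u, v, w} E) : X ⟶ nullQuot A X :=
  X.quotMk (nullSetoid A X) (nullSetoid_funMap X)

lemma nullMk_surjective (X : Alg.{u, v, w} E) : Function.Surjective (nullMk A X) :=
  quotMk_surjective _ _ _

lemma exists_nullMk_desc {X Z : Alg.{u, v, w} E} (hZ : nullObjects A Z) (g : X ⟶ Z) :
    ∃ d, nullMk A X ≫ d = g :=
  exists_desc _ (nullMk_surjective X) g fun x y h => (quotMk_eq_iff _ _ _ x y).1 h Z hZ g

/-- Morphisms to null objects separate the points of the quotient, and each of them kills every
morphism from `A`. -/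
lemma nullObjects_nullQuot (X : Alg.{u, v, w} E) : nullObjects A (nullQuot A X) := fun f => by
  refine (eq_zero_iff f).2 fun a => ?_
  obtain ⟨x, hx⟩ := nullMk_surjective X (f a)
  rw [← hx, ← fn_pt (nullMk A X)]
  refine (quotMk_eq_iff _ _ _ _ _).2 fun Z hZ g => ?_
  obtain ⟨d, rfl⟩ := exists_nullMk_desc hZ g
  rw [comp_fn, comp_fn]
  rw [hx, ← comp_fn, hZ (f ≫ d), zero_fn, fn_pt, fn_pt]

/-- Null objects form a reflective subcategory. -/
lemma nonempty_reflective_nullObjects : Nonempty (Reflective (nullObjects A).ι) := by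
  have hb (X : Alg.{u, v, w} E) (Y : (nullObjects A).FullSubcategory) :
      Function.Bijective (fun f : (⟨nullQuot A X, nullObjects_nullQuot X⟩ :
        (nullObjects A).FullSubcategory) ⟶ Y => nullMk A X ≫ (nullObjects A).ι.map f) := by
    have := epi_of_surjective _ (nullMk_surjective (A := A) X)
    refine ⟨fun f g h => (nullObjects A).ι.map_injective ((cancel_epi _).1 h), fun g => ?_⟩
    obtain ⟨d, hd⟩ := exists_nullMk_desc Y.property g
    exact ⟨ObjectProperty.homMk d, hd⟩
  exact ⟨{ L := _
           adj := Adjunction.adjunctionOfEquivLeft (fun X Y => Equiv.ofBijective _ (hb X Y))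
             fun X Y Y' g h => by simp }⟩

section

variable [Reflective (nullObjects A).ι]

/-- The unit agrees with the projection to the largest null quotient up to a split epimorphism `d'`.
-/
lemma coaug_surjective (X : Alg.{u, v, w} E) :
    Function.Surjective (coaug (nullObjects A) X) := by
  obtain ⟨d, hd⟩ := coaug_desc (nullObjects_nullQuot X) (nullMk A X)
  obtain ⟨d', hd'⟩ := exists_nullMk_desc (localization_prop (nullObjects A) X)
    (coaug (nullObjects A) X)
  have h : d ≫ d' = 𝟙 _ := coaug_cancel (localization_prop (nullObjects A) X) (by
    rw [← Category.assoc, hd, hd', Category.comp_id])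
  intro y
  obtain ⟨x, hx⟩ := nullMk_surjective X (d y)
  refine ⟨x, ?_⟩
  rw [← hd', comp_fn, hx, ← comp_fn, h, id_fn]

instance (X : Alg.{u, v, w} E) : Epi (coaug (nullObjects A) X) :=
  epi_of_surjective _ (coaug_surjective X)

end

variable (A) in
/-- Surjections whose kernel is the image of an algebra all of whose morphisms to null objects
vanish. -/
def NullCover {X Y : Alg.{u, v, w} E} (f : X ⟶ Y) : Prop :=
  Function.Surjective f ∧ ∃ (K : Alg.{u, v, w} E) (k : K ⟶ X),
    (∀ Z, nullObjects A Z → ∀ h : K ⟶ Z, h = 0) ∧ k ≫ f = 0 ∧ ∀ x, f x = Y.pt → ∃ z, k z = x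

lemma NullCover.isLocal (hC : SplitShortFiveLemma (Alg.{u, v, w} E)) {X Y : Alg.{u, v, w} E}
    {f : X ⟶ Y} (hf : NullCover A f) : (nullObjects A).isLocal f := by
  obtain ⟨hs, K, k, hK, -, hk⟩ := hf
  have := epi_of_surjective f hs
  refine fun Z hZ => ⟨fun a b h => (cancel_epi f).1 h, fun g => ?_⟩
  refine exists_desc f hs g fun x y hxy => eq_of_ker hC f g (fun x hx => ?_) hxy
  obtain ⟨z, rfl⟩ := hk x hx
  rw [← comp_fn, hK Z hZ (k ≫ g), zero_fn]

/-- The kernel does not change under pullback, so the same `K` works. -/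
lemma NullCover.of_isPullback {T X Y Z : Alg.{u, v, w} E} {p₁ : T ⟶ X} {p₂ : T ⟶ Y} {f : X ⟶ Z}
    {g : Y ⟶ Z} (h : IsPullback p₁ p₂ f g) (hf : NullCover A f) : NullCover A p₂ := by
  obtain ⟨hs, K, k, hK, hkf, hk⟩ := hf
  refine ⟨fun y => ?_, K, h.lift k 0 (by rw [hkf, zero_comp]), hK, h.lift_snd _ _ _, fun x hx => ?_⟩
  · obtain ⟨x, hx⟩ := hs (g y)
    obtain ⟨z, -, hz⟩ := exists_of_isPullback h x y hx
    exact ⟨z, hz⟩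
  · obtain ⟨z, hz⟩ := hk (p₁ x) (by rw [← comp_fn, h.w, comp_fn, hx, fn_pt])
    refine ⟨z, ext_of_isPullback h ?_ ?_⟩
    · rw [← comp_fn, h.lift_fst, hz]
    · rw [← comp_fn, h.lift_snd, hx, zero_fn]

variable [Reflective (nullObjects A).ι]

/-- If fiberwise localizations exist, then the kernel of each coaugmentation has a trivial
nullification. -/
lemma FunctorialFiberwiseLocalization.nullCover_coaug
    (hC : SplitShortFiveLemma (Alg.{u, v, w} E))
    (Φ : FunctorialFiberwiseLocalization (localization (nullObjects A))
      (coaugmentation (nullObjects A))) (X : Alg.{u, v, w} E) :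
    NullCover A (coaug (nullObjects A) X) := by
  let η := coaug (nullObjects A)
  let k : X.sub (kerSub (η X)) ⟶ X := X.incl _
  have hk : k ≫ η X = 0 := (eq_zero_iff _).2 fun z => z.2
  have hker (x : X.carrier) (hx : η X x = pt _) : ∃ z, k z = x := ⟨⟨x, hx⟩, rfl⟩
  let T : ShortComplex (Alg.{u, v, w} E) := ShortComplex.mk k (η X) hk
  have hT : IsExtension T :=
    (isExtension_iff hC T).2 ⟨incl_injective _ _, hker, coaug_surjective X⟩
  let S : (extensions (Alg.{u, v, w} E)).FullSubcategory := ⟨T, hT⟩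
  have hS := Φ.isExtension S
  have hnull : nullObjects A (Φ.Ebar.obj S) :=
    nullObjects_of_isExtension hS (localization_prop _ _) (localization_prop _ X)
  let j : (localization (nullObjects A)).obj T.X₁ ⟶ Φ.Ebar.obj S := Φ.j.app S
  let e : X ⟶ Φ.Ebar.obj S := Φ.e.app S
  have hje : η T.X₁ ≫ j = k ≫ e := Φ.comm_left S
  -- Nullity of the middle term makes `e` factor through the unit of `X`, so `k ≫ e = 0`.
  obtain ⟨d, hd⟩ := coaug_desc hnull e
  have hη : η T.X₁ = 0 := by
    have : Mono j := mono_of_injective _ ((isExtension_iff hC _).1 hS).1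
    rw [← cancel_mono j, hje, ← hd, ← Category.assoc, hk, zero_comp, zero_comp]
  refine ⟨coaug_surjective X, _, k, fun Z hZ h => ?_, hk, hker⟩
  obtain ⟨d, rfl⟩ := coaug_desc hZ h
  change η T.X₁ ≫ d = 0
  rw [hη, zero_comp]

lemma pullsBackCoaug_of_nullCover (hC : SplitShortFiveLemma (Alg.{u, v, w} E))
    (hη : ∀ X, NullCover A (coaug (nullObjects A) X)) :
    PullsBackCoaug (nullObjects A) :=
  fun _ _ _ _ _ _ _ h => ((hη _).of_isPullback h).isLocal hC

/-- The unit of `K` is an epimorphism, so the composite may be tested on `K`. -/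
lemma localization_map_comp_eq_zero {K X Q : Alg.{u, v, w} E} {k : K ⟶ X} {f : X ⟶ Q}
    (h : k ≫ f = 0) :
    (localization (nullObjects A)).map k ≫ (localization (nullObjects A)).map f = 0 := by
  rw [← cancel_epi (coaug (nullObjects A) K), coaug_naturality_assoc,
    coaug_naturality, ← Category.assoc, h, zero_comp, comp_zero]

/-- For a flat extension `0 ⟶ K ⟶ X ⟶ Q ⟶ 0`, the comparison of `X` with the pullback of its
localization to `Q`. -/
lemma nullCover_of_isFlatExtension (hC : SplitShortFiveLemma (Alg.{u, v, w} E))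
    (hη : ∀ X, NullCover A (coaug (nullObjects A) X))
    {S : ShortComplex (Alg.{u, v, w} E)} (hS : IsFlatExtension (localization (nullObjects A)) S)
    {T : Alg.{u, v, w} E} {p₁ : T ⟶ (localization (nullObjects A)).obj S.X₂} {p₂ : T ⟶ S.X₃}
    (h : IsPullback p₁ p₂ ((localization (nullObjects A)).map S.g)
      (coaug (nullObjects A) S.X₃)) (t : S.X₂ ⟶ T)
    (h₁ : t ≫ p₁ = coaug (nullObjects A) S.X₂) (h₂ : t ≫ p₂ = S.g) :
    NullCover A t := by
  obtain ⟨hS, h0, hP⟩ := hS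
  rw [isExtension_iff hC] at hS hP
  obtain ⟨hf, hfg, hg⟩ := hS
  obtain ⟨hf', hfg', -⟩ := hP
  dsimp only at hf' hfg'
  obtain ⟨-, K, k, hK, hkη, hk⟩ := hη S.X₁
  -- The kernel of `p₂` is that of the localized `S.g`; by flatness it is the localization of
  -- `S.X₁`, onto which the unit is surjective. Since the localized `S.f` is injective, the kernel
  -- of `t` is the image of the kernel of the unit of `S.X₁`.
  refine ⟨surjective_of_ker hC t p₂ (fun x hx => ?_) (by rwa [h₂]), K, k ≫ S.f, hK, ?_,
    fun x hx => ?_⟩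
  · obtain ⟨y, hy⟩ := hfg' (p₁ x) (by rw [← comp_fn, h.w, comp_fn, hx, fn_pt])
    obtain ⟨z, rfl⟩ := coaug_surjective _ y
    refine ⟨S.f z, ext_of_isPullback h ?_ ?_⟩
    · rw [← comp_fn t, h₁, ← hy, ← comp_fn, ← comp_fn, coaug_naturality]
    · rw [← comp_fn t, h₂, hx, fn_fn_eq_pt S.zero]
  · refine h.hom_ext ?_ ?_
    · rw [Category.assoc, Category.assoc, h₁, ← coaug_naturality, ← Category.assoc, hkη,
        zero_comp, zero_comp]
    · rw [Category.assoc, Category.assoc, h₂, S.zero, comp_zero, zero_comp]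
  · obtain ⟨y, rfl⟩ := hfg x (by rw [← h₂, comp_fn, hx, fn_pt])
    obtain ⟨z, rfl⟩ := hk y (hf' (by
      rw [← comp_fn, coaug_naturality, comp_fn, ← h₁, comp_fn, hx, fn_pt, fn_pt]))
    exact ⟨z, rfl⟩

/-- The localization preserves the pullbacks of flat extensions. -/
lemma isPullback_localization_map (hC : SplitShortFiveLemma (Alg.{u, v, w} E))
    (hη : ∀ X, NullCover A (coaug (nullObjects A) X))
    {S : ShortComplex (Alg.{u, v, w} E)} (hS : IsFlatExtension (localization (nullObjects A)) S)
    {W X : Alg.{u, v, w} E} {a : W ⟶ S.X₂} {b : W ⟶ X} {c : X ⟶ S.X₃}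
    (h : IsPullback a b S.g c) :
    IsPullback ((localization (nullObjects A)).map a) ((localization (nullObjects A)).map b)
      ((localization (nullObjects A)).map S.g) ((localization (nullObjects A)).map c) := by
  let η := coaug (nullObjects A)
  have hE := pb_isPullback ((localization (nullObjects A)).map S.g) (η S.X₃)
  have hY := pb_isPullback ((localization (nullObjects A)).map S.g)
    ((localization (nullObjects A)).map c)
  have hX := pb_isPullback
    (pbSnd ((localization (nullObjects A)).map S.g) ((localization (nullObjects A)).map c)) (η X)
  let t : S.X₂ ⟶ pb ((localization (nullObjects A)).map S.g) (η S.X₃) :=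
    hE.lift (η S.X₂) S.g (coaug_naturality S.g)
  have ht : NullCover A t := nullCover_of_isFlatExtension hC hη hS hE t (hE.lift_fst _ _ _)
    (hE.lift_snd _ _ _)
  -- the pullback of `pb ((localization (nullObjects A)).map S.g) (η S.X₃)` to `X`
  have hX' := hX.paste_horiz hY
  rw [coaug_naturality c] at hX'
  obtain ⟨m, hm₁, hm₂⟩ := hE.exists_lift
    (pbFst _ (η X) ≫ pbFst _ ((localization (nullObjects A)).map c)) (pbSnd _ _ ≫ c)
    (by rw [hX'.w, Category.assoc])
  -- Thus the pullback of the localized `S.g` along `X` is also the base change along `c` of the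
  -- target of `t`, which makes `n` a pullback of `t`.
  have hXE := IsPullback.of_right (h₁₁ := m) (by rwa [hm₁]) hm₂ hE
  obtain ⟨n, hn₁, hn₂⟩ := hXE.exists_lift (a ≫ t) b (by
    rw [Category.assoc, hE.lift_snd, h.w])
  have hn : NullCover A n :=
    ht.of_isPullback (IsPullback.of_bot (by rwa [hn₂, hE.lift_snd]) hn₁.symm hXE)
  have hs : (nullObjects A).isLocal (n ≫ pbFst _ _) :=
    (nullObjects A).isLocal.comp_mem _ _ (hn.isLocal hC) (((hη X).of_isPullback hX.flip).isLocal hC)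
  have hYnull : nullObjects A
      (pb ((localization (nullObjects A)).map S.g) ((localization (nullObjects A)).map c)) :=
    nullObjects_of_isPullback hY (localization_prop _ _) (localization_prop _ _)
  -- A local equivalence from `W` to a null object is a reflection of `W`, so `θ` is invertible.
  obtain ⟨θ, hθ⟩ := coaug_desc hYnull (n ≫ pbFst _ _)
  have : IsIso θ := by
    rw [← (nullObjects A).isLocal_iff_isIso θ (localization_prop _ _) hYnull]
    exact (nullObjects A).isLocal.of_precomp _ _ (isLocal_coaug _ W) (by rwa [hθ])
  refine hY.of_iso (asIso θ).symm (Iso.refl _) (Iso.refl _) (Iso.refl _) ?_ ?_ (by simp) (by simp)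
  · rw [Iso.refl_hom, Category.comp_id, Iso.symm_hom, Iso.eq_inv_comp, asIso_hom,
      ← cancel_epi (η W), ← Category.assoc, hθ, coaug_naturality, Category.assoc,
      ← hm₁, ← Category.assoc n, hn₁, Category.assoc, hE.lift_fst]
  · rw [Iso.refl_hom, Category.comp_id, Iso.symm_hom, Iso.eq_inv_comp, asIso_hom,
      ← cancel_epi (η W), ← Category.assoc, hθ, coaug_naturality, Category.assoc,
      hX.w, ← Category.assoc, hn₂]

lemma conditionallyFlat_of_nullCover (hC : SplitShortFiveLemma (Alg.{u, v, w} E))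
    (hη : ∀ X, NullCover A (coaug (nullObjects A) X)) :
    ConditionallyFlat (localization (nullObjects A)) := by
  intro S' S φ hS _ h
  refine ⟨isExtension_of_isPullback hC φ hS.1 h, localization_map_comp_eq_zero S'.zero, ?_⟩
  let P := localization (nullObjects A)
  let Φ : ShortComplex.mk _ _ (localization_map_comp_eq_zero (A := A) S'.zero) ⟶
      ShortComplex.mk _ _ hS.2.choose :=
    { τ₁ := P.map φ.τ₁
      τ₂ := P.map φ.τ₂
      τ₃ := P.map φ.τ₃
      comm₁₂ := by dsimp only; rw [← P.map_comp, ← P.map_comp, φ.comm₁₂]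
      comm₂₃ := by dsimp only; rw [← P.map_comp, ← P.map_comp, φ.comm₂₃] }
  have : IsIso Φ.τ₁ := inferInstanceAs (IsIso (P.map φ.τ₁))
  -- The stability of extensions under pullback applies a second time, now to the localized
  -- sequences.
  exact isExtension_of_isPullback hC Φ hS.2.choose_spec (isPullback_localization_map hC hη hS h)

end Nullification

end SemiAb

theorem corollary7p2 {L : FirstOrder.Language.{u, v}} [L.IsAlgebraic]
    (E : Set (L.Term ℕ × L.Term ℕ))
    [HasZeroMorphisms (SemiAb.Alg.{u, v, w} E)] [SemiAb.SemiAbelian (SemiAb.Alg.{u, v, w} E)]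
    (A : SemiAb.Alg.{u, v, w} E) :
    Nonempty (Reflective (SemiAb.nullObjects A).ι) ∧
    ∀ [Reflective (SemiAb.nullObjects A).ι],
      Nonempty (SemiAb.FunctorialFiberwiseLocalization
        (SemiAb.localization (SemiAb.nullObjects A))
        (SemiAb.coaugmentation (SemiAb.nullObjects A))) →
      SemiAb.SemiLeftExact (SemiAb.nullObjects A) ∧
      SemiAb.ConditionallyFlat (SemiAb.localization (SemiAb.nullObjects A)) ∧
      ∃ M : ModelCategory (SemiAb.Alg.{u, v, w} E),
        SemiAb.IsLocalModelStructure (SemiAb.localization (SemiAb.nullObjects A)) M ∧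
        SemiAb.RightProper M := by
  refine ⟨SemiAb.nonempty_reflective_nullObjects, fun ⟨Φ⟩ => ?_⟩
  have hC := SemiAb.Homological.splitShortFive (C := SemiAb.Alg.{u, v, w} E)
  have : Regular (SemiAb.Alg.{u, v, w} E) := SemiAb.Homological.regular
  have : HasFiniteColimits (SemiAb.Alg.{u, v, w} E) := SemiAb.SemiAbelian.hasFiniteColimits
  have hη := Φ.nullCover_coaug hC
  have H := SemiAb.pullsBackCoaug_of_nullCover hC hη
  exact ⟨H.semiLeftExact, SemiAb.conditionallyFlat_of_nullCover hC hη, H.exists_modelCategory⟩
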